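/- Let $G$ be a graph (or hypergraph) with finite vertex set $V$. A bad coloring is a pair $(Z,c)$ where $Z\subset V$ is nonempty and $c$ is a coloring of $Z$; let a set of bad colorings be given. A coloring of $V$ avoids $(Z,c)$ if its restriction to $Z$ is not $c$. Let $\mathcal Z=\{Z_i: i\in I\}$ (with the $Z_i$ distinct) be the finite set of all $Z$ that carry at least one bad coloring, and let $C_i$ be the set of all $c$ such that $(Z_i,c)$ is bad. Suppose that for each $i\in I$ there are natural numbers $k_i,m_i$ such that for every $v\in Z_i$ one can choose $k_i$ vertices of $Z_i$, all different from $v$, with the property that each coloring of these $k_i$ vertices extends in at most $m_i$ ways to a coloring $c\in C_i$ of $Z_i$. Put $l_i=|Z_i|-k_i$ and $E=\{l_i: i\in I\}$; for $l\in E$ let $d_l$ be the maximum over $v\in V$ of the number of sets $Z_j\in\mathcal Z$ with $v\in Z_j$ and $l_j=l$. Let $\phi_E(x)=1+\sum_{l\in E}x^l$, let $\tau>0$ be a solution of $\phi_E(\tau)-\tau\phi_E'(\tau)=0$, and let $\gamma=\phi_E'(\tau)$. Set $$N=\Big\lceil \gamma\cdot\sup_{i\in I}(d_{l_i}m_i)^{1/l_i}\Big\rceil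 .$$ (1) For every set $S$ of $N$ colors there is a coloring of $V$ with colors from $S$ that avoids every bad coloring. (2) (Variable version.) Let $(\psi_v)_{v\in V}$ be finitely many independent random variables with finite images on a probability space, and let $(A_x)_{x\in X}$ be events, each $A_x$ determined by the values of the variables $\psi_v$ with $v$ in a set $\mathrm{vbl}(A_x)\subset V$. Regard the value of $\psi_v$ as the color of $v$, and let the bad colorings be the pairs $(\mathrm{vbl}(A_x),c)$ where $c$ is a configuration of the variables in $\mathrm{vbl}(A_x)$ that makes $A_x$ occur. Then an outcome lies in no $A_x$ if and only if the coloring $(\psi_v)_{v\in V}$ that it produces avoids every bad coloring. Moreover, if $\mathcal Z$, $k_i$, $m_i$, $\tau$ and $N$ are as above for these bad colorings (in particular all $Z\in\mathcal Z$ are nonempty) and every $\psi_v$ takes at least $N$ values with positive probability, then with positive probability no event $A_x$ occurs. -/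

import Mathlib

open MeasureTheory ProbabilityTheory

namespace BadColoring

/-- A pair `(Z, c)`: a set `Z` of vertices with a coloring `c` of `Z`. The colors of the vertex `v`
are the elements of `α v`; for an ordinary coloring problem `α` is constant. -/
abbrev PartialColoring (V : Type*) (α : V → Type*) : Type _ :=
  Σ Z : Finset V, ((v : Z) → α v)

variable {V : Type*} {α : V → Type*}

/-- The coloring `f` of all the vertices avoids the set `B` of bad colorings: for no `(Z, c)` in `B`
is `c` the restriction of `f` to `Z`. -/
def Avoids (B : Set (PartialColoring V α)) (f : (v : V) → α v) : Prop :=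
  ∀ b ∈ B, (fun v : b.1 => f v) ≠ b.2

/-- `C_Z`: the bad colorings of `Z`. -/
def badOn (B : Set (PartialColoring V α)) (Z : Finset V) : Set ((v : Z) → α v) :=
  {c | (⟨Z, c⟩ : PartialColoring V α) ∈ B}

/-- `l_Z = |Z| - k_Z`. -/
def len (k : Finset V → ℕ) (Z : Finset V) : ℕ := Z.card - k Z

/-- `φ_E(x) = 1 + ∑_{l ∈ E} x ^ l`. -/
def phi (E : Finset ℕ) (x : ℝ) : ℝ := 1 + ∑ l ∈ E, x ^ l

/-- `τ` is a positive solution of `φ_E(x) - x φ_E'(x) = 0`. -/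
def IsTau (E : Finset ℕ) (τ : ℝ) : Prop := 0 < τ ∧ phi E τ - τ * deriv (phi E) τ = 0

variable [Fintype V]

open Classical in
/-- The set `𝒵` of all `Z` that carry at least one bad coloring. -/
noncomputable def supports (B : Set (PartialColoring V α)) : Finset (Finset V) :=
  Finset.univ.filter fun Z => (badOn B Z).Nonempty

/-- For every `Z` in `𝒵` and every `v` in `Z` there are `k_Z` vertices of `Z`, all different from
`v`, such that each coloring of them extends in at most `m_Z` ways to a bad coloring of `Z`. -/
def ExtensionBound (B : Set (PartialColoring V α)) (k m : Finset V → ℕ) : Prop :=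
  ∀ Z ∈ supports B, ∀ v ∈ Z, ∃ K : Finset V, ∃ hK : K ⊆ Z, v ∉ K ∧ K.card = k Z ∧
    ∀ p : (u : K) → α u,
      {c ∈ badOn B Z | ∀ u : K, c ⟨u, hK u.2⟩ = p u}.encard ≤ m Z

/-- `E`, the set of all values `l_Z` with `Z` in `𝒵`. -/
noncomputable def lens (B : Set (PartialColoring V α)) (k : Finset V → ℕ) : Finset ℕ :=
  (supports B).image (len k)

open Classical in
/-- `d_l`: the maximum over the vertices `v` of the number of `Z` in `𝒵` with `v ∈ Z` and
`l_Z = l`. -/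
noncomputable def deg (B : Set (PartialColoring V α)) (k : Finset V → ℕ) (l : ℕ) : ℕ :=
  Finset.univ.sup fun v : V => ((supports B).filter fun Z => v ∈ Z ∧ len k Z = l).card

/-- `⌈γ · sup_Z (d_{l_Z} m_Z) ^ (1 / l_Z)⌉` with `γ = φ_E'(τ)`. -/
noncomputable def numColors (B : Set (PartialColoring V α)) (k m : Finset V → ℕ) (τ : ℝ) : ℕ :=
  ⌈deriv (phi (lens B k)) τ *
    ⨆ Z : supports B, ((deg B k (len k Z) : ℝ) * (m Z : ℝ)) ^ (1 / (len k Z : ℝ))⌉₊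

end BadColoring

namespace VariableVersion

/-- The event `A` is determined by the values of the variables `ψ v` with `v ∈ S`. -/
def DeterminedBy {V Ω : Type*} {α : V → Type*} (ψ : (v : V) → Ω → α v) (A : Set Ω)
    (S : Finset V) : Prop :=
  ∀ ω ω' : Ω, (∀ v ∈ S, ψ v ω = ψ v ω') → (ω ∈ A ↔ ω' ∈ A)

/-- The coloring problem of a family of events: the vertices are the variables, and the bad
colorings are the pairs `(vbl x, c)` where `c` is a configuration of the variables in `vbl x` that
makes the event `A x` occur. -/
def badConfigs {V Ω X : Type*} {α : V → Type*} (ψ : (v : V) → Ω → α v) (A : X → Set Ω)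
    (vbl : X → Finset V) : Set (BadColoring.PartialColoring V α) :=
  {b | ∃ x : X, ∃ ω ∈ A x, b = ⟨vbl x, fun v => ψ v ω⟩}

end VariableVersion

/-! Counting by induction on the colored set. Let g(U) be the number of good colorings of U; the
claim is g(U ∪ {v}) ≥ β g(U) for a suitable β > 0. Coloring v freely gives |L v| g(U) candidates. A
failing candidate is bad on some Z containing v. Erase its colors on Z \ K, where K is the set of
k_Z vertices provided for v: a good coloring of U \ (Z \ K) remains, and it arises from at most m_Z
candidates. Only l_Z - 1 vertices of U were lost, so by induction at most m_Z g(U) / β ^ (l_Z - 1)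
candidates fail at Z (`pow_mul_card_filter_bad_le`). The claim follows if β plus the sum of m_Z / β
^ (l_Z - 1) over Z containing v is at most |L v|. With M the supremum in `numColors`, that left side
is at most M φ_E(τ) / τ = γ M when β = M / τ (`IsTau.add_sum_eq`). The variable version takes as
lists the values of positive probability. -/

namespace BadColoring

open Finset

/-! ### Counting good colorings -/

section Counting

variable {V : Type*} {α : V → Type*} [Fintype V]

open Classical in
/-- The colorings with colors from the lists `L` that agree with `f₀` outside `U` and avoid all the
bad colorings of subsets of `U`: a model of the good colorings of `U`. -/
noncomputable def goodColorings (B : Set (PartialColoring V α)) (L : (v : V) → Finset (α v))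
    (f₀ : (v : V) → α v) (U : Finset V) : Finset ((v : V) → α v) :=
  (Fintype.piFinset L).filter fun f => (∀ v, v ∉ U → f v = f₀ v) ∧
    ∀ b ∈ B, b.1 ⊆ U → (fun v : b.1 => f v) ≠ b.2

open Classical in
/-- The colorings of `insert v U` whose restriction to `U` is good. -/
noncomputable def extensions (B : Set (PartialColoring V α)) (L : (v : V) → Finset (α v))
    (f₀ : (v : V) → α v) (U : Finset V) (v : V) : Finset ((v : V) → α v) :=
  (Fintype.piFinset L).filter fun f => (∀ w, w ∉ U → w ≠ v → f w = f₀ w) ∧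
    ∀ b ∈ B, b.1 ⊆ U → (fun v : b.1 => f v) ≠ b.2

variable {B : Set (PartialColoring V α)} {L : (v : V) → Finset (α v)} {f₀ : (v : V) → α v}
  {k m : Finset V → ℕ}

theorem mem_goodColorings {U : Finset V} {f : (v : V) → α v} :
    f ∈ goodColorings B L f₀ U ↔ (∀ v, f v ∈ L v) ∧ (∀ v, v ∉ U → f v = f₀ v) ∧
      ∀ b ∈ B, b.1 ⊆ U → (fun v : b.1 => f v) ≠ b.2 := by
  simp [goodColorings]

theorem mem_extensions {U : Finset V} {v : V} {f : (v : V) → α v} :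
    f ∈ extensions B L f₀ U v ↔ (∀ w, f w ∈ L w) ∧ (∀ w, w ∉ U → w ≠ v → f w = f₀ w) ∧
      ∀ b ∈ B, b.1 ⊆ U → (fun v : b.1 => f v) ≠ b.2 := by
  simp [extensions]

theorem mem_supports {Z : Finset V} : Z ∈ supports B ↔ (badOn B Z).Nonempty := by
  simp [supports]

theorem card_mul_card_le_card_extensions {U : Finset V} {v : V} (hv : v ∉ U) :
    (L v).card * (goodColorings B L f₀ U).card ≤ (extensions B L f₀ U v).card := by
  classical
  rw [← card_product]
  refine card_le_card_of_injOn (fun p => Function.update p.2 v p.1) ?_ ?_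
  · rintro ⟨a, g⟩ h
    simp only [mem_coe, mem_product, mem_goodColorings] at h
    obtain ⟨ha, hL, hg, hb⟩ := h
    simp only [mem_coe, mem_extensions]
    refine ⟨fun w => ?_, fun w hw hwv => ?_, fun b hbB hbU h => hb b hbB hbU ?_⟩
    · by_cases hwv : w = v
      · subst hwv; simpa using ha
      · simpa [hwv] using hL w
    · simpa [hwv] using hg w hw
    · rw [← h]
      funext w
      have : (w : V) ≠ v := fun e => hv (e ▸ hbU w.2)
      simp [this]
  · rintro ⟨a, g⟩ h ⟨a', g'⟩ h' he
    simp only [mem_coe, mem_product, mem_goodColorings] at h h' he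
    have hval : ∀ w, Function.update g v a w = Function.update g' v a' w := congrFun he
    have haa : a = a' := by simpa using hval v
    have hgg : g = g' := by
      funext w
      by_cases hwv : w = v
      · subst hwv
        rw [h.2.2.1 w hv, h'.2.2.1 w hv]
      · simpa [hwv] using hval w
    rw [haa, hgg]

-- Erasing the colors on Z \ K is at most M-to-one: the image still shows the colors on K, hence
-- leaves at most M bad colorings of Z, and these restore the rest.
open Classical in
theorem card_filter_bad_le {U Z K : Finset V} {v : V} {M : ℕ} (hf₀ : ∀ w, f₀ w ∈ L w)
    (hZ : Z ⊆ insert v U) (hK : K ⊆ Z) (hvK : v ∉ K) (hvZ : v ∈ Z)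
    (hM : ∀ p : (u : K) → α u,
      {c ∈ badOn B Z | ∀ u : K, c ⟨u, hK u.2⟩ = p u}.encard ≤ M) :
    ((extensions B L f₀ U v).filter fun f => (fun w : Z => f w) ∈ badOn B Z).card ≤
      M * (goodColorings B L f₀ (U \ (Z \ K))).card := by
  have hKU : ∀ u ∈ K, u ∈ U \ (Z \ K) := by
    intro u hu
    have : u ≠ v := fun e => hvK (e ▸ hu)
    have := hZ (hK hu)
    simp_all
  refine card_le_mul_card_image_of_maps_to
    (f := fun f w => if w ∈ U \ (Z \ K) then f w else f₀ w) ?_ M ?_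
  · intro f hf
    simp only [mem_filter, mem_extensions] at hf
    obtain ⟨⟨hL, -, hb⟩, -⟩ := hf
    simp only [mem_goodColorings]
    refine ⟨fun w => ?_, fun w hw => if_neg hw, fun b hbB hbU h => hb b hbB ?_ ?_⟩
    · split_ifs
      exacts [hL w, hf₀ w]
    · exact hbU.trans sdiff_subset
    · rw [← h]
      funext w
      exact (if_pos (hbU w.2)).symm
  · intro g _
    have hfin := hM fun u => g u
    rw [← ENat.natCast_le_natCast, ← Set.encard_coe_eq_coe_finsetCard]
    refine le_trans (Set.encard_le_encard_of_injOn (f := fun f (w : Z) => f w) ?_ ?_) hfin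
    · intro f hf
      simp only [mem_coe, mem_filter] at hf
      refine ⟨hf.1.2, fun u => ?_⟩
      have := congrFun hf.2 u
      simpa only [if_pos (hKU u u.2)] using this
    · intro f hf f' hf' he
      simp only [mem_coe, mem_filter, mem_extensions] at hf hf'
      funext w
      by_cases hwZ : w ∈ Z
      · exact congrFun he ⟨w, hwZ⟩
      by_cases hwU : w ∈ U
      · have hw : w ∈ U \ (Z \ K) := by simp [hwU, hwZ]
        have := congrFun (hf.2.trans hf'.2.symm) w
        simpa only [if_pos hw] using this
      · have hwv : w ≠ v := fun e => hwZ (e ▸ hvZ)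
        rw [hf.1.1.2.1 w hwU hwv, hf'.1.1.2.1 w hwU hwv]

open Classical in
theorem pow_mul_card_filter_bad_le {U Z : Finset V} {v : V} {β : ℝ} (hβ : 0 < β)
    (hf₀ : ∀ w, f₀ w ∈ L w) (hB : ExtensionBound B k m) (hZB : Z ∈ supports B) (hvZ : v ∈ Z)
    (hv : v ∉ U) (hZ : Z ⊆ insert v U)
    (hU : ∀ W ⊆ U, β ^ (U \ W).card * (goodColorings B L f₀ W).card ≤
      (goodColorings B L f₀ U).card) :
    β ^ (len k Z - 1) * (((extensions B L f₀ U v).filter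
      fun f => (fun w : Z => f w) ∈ badOn B Z).card : ℝ) ≤
      m Z * (goodColorings B L f₀ U).card := by
  obtain ⟨K, hK, hvK, hKc, hM⟩ := hB Z hZB v hvZ
  have hcard := card_filter_bad_le (L := L) hf₀ hZ hK hvK hvZ hM
  have hsub := hU (U \ (Z \ K)) sdiff_subset
  have hset : U \ (U \ (Z \ K)) = (Z \ K).erase v := by
    ext w
    have := @hZ w
    simp only [mem_sdiff, mem_erase, mem_insert] at *
    by_cases hwv : w = v
    · subst hwv; simp [hv]
    · tauto
  -- The exponent is one less than `len k Z` because v is in Z \ K but not in U.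
  have hlen : (U \ (U \ (Z \ K))).card = len k Z - 1 := by
    rw [hset, card_erase_of_mem (by simp [hvZ, hvK]), card_sdiff_of_subset hK, hKc, len]
  rw [hlen] at hsub
  have hcard' : (((extensions B L f₀ U v).filter
      fun f => (fun w : Z => f w) ∈ badOn B Z).card : ℝ) ≤
      m Z * (goodColorings B L f₀ (U \ (Z \ K))).card := by
    exact_mod_cast hcard
  calc _ ≤ β ^ (len k Z - 1) * (m Z * (goodColorings B L f₀ (U \ (Z \ K))).card : ℝ) := by
        gcongr
    _ = m Z * (β ^ (len k Z - 1) * (goodColorings B L f₀ (U \ (Z \ K))).card) := by ring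
    _ ≤ _ := by gcongr

open Classical in
theorem extensions_subset (U : Finset V) (v : V) :
    extensions B L f₀ U v ⊆ goodColorings B L f₀ (insert v U) ∪
      ((supports B).filter fun Z => v ∈ Z).biUnion fun Z =>
        if Z ⊆ insert v U then
          (extensions B L f₀ U v).filter fun f => (fun w : Z => f w) ∈ badOn B Z
        else ∅ := by
  intro f hf
  by_cases hg : f ∈ goodColorings B L f₀ (insert v U)
  · exact mem_union_left _ hg
  refine mem_union_right _ ?_
  have hf' := mem_extensions.1 hf
  rw [mem_goodColorings] at hg
  have : ∃ b ∈ B, b.1 ⊆ insert v U ∧ (fun v : b.1 => f v) = b.2 := by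
    by_contra! h
    refine hg ⟨hf'.1, fun w hw => ?_, h⟩
    rw [mem_insert, not_or] at hw
    exact hf'.2.1 w hw.2 hw.1
  obtain ⟨⟨Z, c⟩, hb, hZ, hc⟩ := this
  change (fun w : Z => f w) = c at hc
  rw [← hc] at hb
  -- Otherwise Z would lie in U, where f is already good.
  have hvZ : v ∈ Z := by
    by_contra h
    exact hf'.2.2 _ hb ((subset_insert_iff_of_notMem h).1 hZ) rfl
  have hbad : (fun w : Z => f w) ∈ badOn B Z := hb
  simp only [mem_biUnion, mem_filter, mem_supports]
  exact ⟨Z, ⟨⟨_, hb⟩, hvZ⟩, by rw [if_pos hZ]; simp [hf, hbad]⟩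

open Classical in
theorem mul_card_goodColorings_le {U : Finset V} {v : V} {β : ℝ} (hβ : 0 < β)
    (hf₀ : ∀ w, f₀ w ∈ L w) (hB : ExtensionBound B k m) (hv : v ∉ U)
    (hL : β + ∑ Z ∈ supports B with v ∈ Z, (m Z : ℝ) / β ^ (len k Z - 1) ≤ (L v).card)
    (hU : ∀ W ⊆ U, β ^ (U \ W).card * (goodColorings B L f₀ W).card ≤
      (goodColorings B L f₀ U).card) :
    β * (goodColorings B L f₀ U).card ≤ (goodColorings B L f₀ (insert v U)).card := by
  have h₁ := (card_mul_card_le_card_extensions (B := B) (L := L) (f₀ := f₀) hv).trans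
    ((card_le_card (extensions_subset U v)).trans (card_union_le _ _))
  have h₂ := h₁.trans (Nat.add_le_add_left card_biUnion_le _)
  have h₃ : ((L v).card : ℝ) * (goodColorings B L f₀ U).card ≤
      (goodColorings B L f₀ (insert v U)).card +
        ∑ Z ∈ supports B with v ∈ Z, (m Z : ℝ) / β ^ (len k Z - 1) *
          (goodColorings B L f₀ U).card := by
    have h₄ := (Nat.cast_le (α := ℝ)).2 h₂
    push_cast at h₄
    refine h₄.trans (add_le_add le_rfl (sum_le_sum fun Z hZ => ?_))
    rw [mem_filter] at hZ
    split_ifs with hZU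
    · have := pow_mul_card_filter_bad_le hβ hf₀ hB hZ.1 hZ.2 hv hZU hU
      rwa [div_mul_eq_mul_div, le_div_iff₀ (by positivity), mul_comm]
    · simp only [card_empty, Nat.cast_zero]
      positivity
  rw [← sum_mul] at h₃
  have := mul_le_mul_of_nonneg_right hL (Nat.cast_nonneg (α := ℝ) (goodColorings B L f₀ U).card)
  linarith

-- The growth step for U needs the bound for arbitrary subsets of the smaller set, hence strong
-- induction with W quantified inside.
open Classical in
theorem pow_card_sdiff_mul_card_le {β : ℝ} (hβ : 0 < β)
    (hf₀ : ∀ w, f₀ w ∈ L w) (hB : ExtensionBound B k m)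
    (hL : ∀ v, β + ∑ Z ∈ supports B with v ∈ Z, (m Z : ℝ) / β ^ (len k Z - 1) ≤ (L v).card)
    (U : Finset V) : ∀ W ⊆ U, β ^ (U \ W).card * (goodColorings B L f₀ W).card ≤
      (goodColorings B L f₀ U).card := by
  induction U using Finset.strongInduction with
  | H U ih =>
    intro W hWU
    rcases hWU.eq_or_ssubset with rfl | hss
    · simp
    obtain ⟨u, huU, huW⟩ := exists_of_ssubset hss
    have hih := ih _ (erase_ssubset huU)
    have hstep := mul_card_goodColorings_le hβ hf₀ hB (notMem_erase u U) (hL u) hih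
    rw [insert_erase huU] at hstep
    have hW := hih W (subset_erase.2 ⟨hWU, huW⟩)
    have hcard : (U \ W).card = (U.erase u \ W).card + 1 := by
      rw [erase_sdiff_comm, card_erase_add_one (by simp [huU, huW])]
    calc _ = β * (β ^ (U.erase u \ W).card * (goodColorings B L f₀ W).card) := by
          rw [hcard]; ring
      _ ≤ β * (goodColorings B L f₀ (U.erase u)).card := by gcongr
      _ ≤ _ := hstep

open Classical in
/-- Counting criterion for the existence of a coloring from lists that avoids all bad colorings. -/
theorem exists_avoids_of_sum_le {β : ℝ} (hβ : 0 < β) (hne : ∀ Z ∈ supports B, Z.Nonempty)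
    (hB : ExtensionBound B k m)
    (hL : ∀ v, β + ∑ Z ∈ supports B with v ∈ Z, (m Z : ℝ) / β ^ (len k Z - 1) ≤ (L v).card) :
    ∃ f : (v : V) → α v, (∀ v, f v ∈ L v) ∧ Avoids B f := by
  have hLne : ∀ v, (L v).Nonempty := by
    intro v
    rw [← card_pos, ← Nat.cast_pos (α := ℝ)]
    refine lt_of_lt_of_le ?_ (hL v)
    have : 0 ≤ ∑ Z ∈ supports B with v ∈ Z, (m Z : ℝ) / β ^ (len k Z - 1) := by positivity
    linarith
  choose f₀ hf₀ using hLne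
  -- The induction starts from a positive count because no bad coloring has empty support.
  have hempty : f₀ ∈ goodColorings B L f₀ ∅ := by
    refine mem_goodColorings.2 ⟨hf₀, fun _ _ => rfl, fun b hb hb0 => ?_⟩
    have := hne b.1 (mem_supports.2 ⟨b.2, hb⟩)
    exact absurd (subset_empty.1 hb0) this.ne_empty
  have hpos : 0 < (goodColorings B L f₀ ∅).card := card_pos.2 ⟨_, hempty⟩
  have h := pow_card_sdiff_mul_card_le hβ hf₀ hB hL univ ∅ (empty_subset _)
  have : (0 : ℝ) < (goodColorings B L f₀ univ).card := lt_of_lt_of_le (by positivity) h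
  obtain ⟨f, hf⟩ := card_pos.1 (Nat.cast_pos.1 this)
  rw [mem_goodColorings] at hf
  exact ⟨f, hf.1, fun b hb => hf.2.2 b hb (subset_univ _)⟩

end Counting

/-! ### Choice of β and the number of colors -/

section Parameters

variable {V : Type*} {α : V → Type*} [Fintype V] {B : Set (PartialColoring V α)}
  {k m : Finset V → ℕ}

open Classical in
theorem card_filter_le_deg (v : V) (l : ℕ) :
    ((supports B).filter fun Z => v ∈ Z ∧ len k Z = l).card ≤ deg B k l :=
  Finset.le_sup (f := fun v : V => ((supports B).filter fun Z => v ∈ Z ∧ len k Z = l).card)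
    (mem_univ v)

theorem one_le_deg {Z : Finset V} (hZ : Z ∈ supports B) (hne : Z.Nonempty) :
    1 ≤ deg B k (len k Z) := by
  classical
  obtain ⟨v, hv⟩ := hne
  exact (card_pos.2 ⟨Z, by simp [hZ, hv]⟩ : 0 < _).trans_le (card_filter_le_deg v _)

theorem ExtensionBound.one_le_len (hB : ExtensionBound B k m) {Z : Finset V}
    (hZ : Z ∈ supports B) (hne : Z.Nonempty) : 1 ≤ len k Z := by
  obtain ⟨v, hv⟩ := hne
  obtain ⟨K, hK, hvK, hKc, -⟩ := hB Z hZ v hv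
  have := card_lt_card ((ssubset_iff_of_subset hK).2 ⟨v, hv, hvK⟩)
  rw [len]
  omega

theorem ExtensionBound.one_le_mult (hB : ExtensionBound B k m) {Z : Finset V}
    (hZ : Z ∈ supports B) (hne : Z.Nonempty) : 1 ≤ m Z := by
  obtain ⟨v, hv⟩ := hne
  obtain ⟨K, hK, -, -, hM⟩ := hB Z hZ v hv
  obtain ⟨c, hc⟩ := mem_supports.1 hZ
  have h := hM fun u => c ⟨u, hK u.2⟩
  have hpos : 1 ≤ {c' ∈ badOn B Z | ∀ u : K, c' ⟨u, hK u.2⟩ = c ⟨u, hK u.2⟩}.encard :=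
    Set.one_le_encard_iff_nonempty.2 ⟨c, hc, fun _ => rfl⟩
  exact_mod_cast hpos.trans h

/-- Without bad colorings φ_E is constantly 1 and the equation for τ reads 1 = 0. This makes M
positive later. -/
theorem IsTau.supports_nonempty {τ : ℝ} (hτ : IsTau (lens B k) τ) : (supports B).Nonempty := by
  by_contra h
  rw [not_nonempty_iff_eq_empty] at h
  have h2 := hτ.2
  have : phi (lens B k) = fun _ => (1 : ℝ) := by
    funext x
    simp [phi, lens, h]
  rw [this] at h2
  simp at h2

-- Group the sets through v by l: there are at most d_l of them, each with m_Z ≤ M ^ l / d_l, so d_l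
-- cancels.
open Classical in
theorem sum_mult_div_pow_le {M β : ℝ} (hβ : 0 < β) (hne : ∀ Z ∈ supports B, Z.Nonempty)
    (hM : ∀ Z ∈ supports B, (deg B k (len k Z) : ℝ) * m Z ≤ M ^ len k Z) (v : V) :
    ∑ Z ∈ supports B with v ∈ Z, (m Z : ℝ) / β ^ (len k Z - 1) ≤
      ∑ l ∈ lens B k, M ^ l / β ^ (l - 1) := by
  have hmaps : ∀ Z ∈ (supports B).filter (fun Z => v ∈ Z), len k Z ∈ lens B k := fun Z hZ =>
    mem_image_of_mem _ (mem_filter.1 hZ).1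
  rw [← sum_fiberwise_of_maps_to hmaps]
  refine sum_le_sum fun l hl => ?_
  obtain ⟨Z₀, hZ₀, rfl⟩ := mem_image.1 hl
  have hd : (0 : ℝ) < deg B k (len k Z₀) := by exact_mod_cast one_le_deg hZ₀ (hne Z₀ hZ₀)
  have hM0 : 0 ≤ M ^ len k Z₀ := le_trans (by positivity) (hM Z₀ hZ₀)
  set l := len k Z₀
  have hbound : ∀ Z ∈ ((supports B).filter fun Z => v ∈ Z).filter (fun Z => len k Z = l),
      (m Z : ℝ) / β ^ (len k Z - 1) ≤ M ^ l / deg B k l / β ^ (l - 1) := by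
    intro Z hZ
    simp only [mem_filter] at hZ
    have := hM Z hZ.1.1
    rw [hZ.2] at this ⊢
    gcongr
    rw [le_div_iff₀ hd, mul_comm]
    exact this
  refine (sum_le_card_nsmul _ _ _ hbound).trans ?_
  rw [filter_filter, nsmul_eq_mul]
  have hc : (((supports B).filter fun Z => v ∈ Z ∧ len k Z = l).card : ℝ) ≤ deg B k l := by
    exact_mod_cast card_filter_le_deg v l
  calc _ ≤ (deg B k l : ℝ) * (M ^ l / deg B k l / β ^ (l - 1)) := by gcongr
    _ = _ := by field_simp

/-- With `β = M / τ` the counting criterion becomes `γ M ≤ N`. -/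
theorem IsTau.add_sum_eq {E : Finset ℕ} {τ M : ℝ} (hτ : IsTau E τ) (hM : 0 < M)
    (hE : ∀ l ∈ E, 1 ≤ l) :
    M / τ + ∑ l ∈ E, M ^ l / (M / τ) ^ (l - 1) = deriv (phi E) τ * M := by
  obtain ⟨hpos, heq⟩ := hτ
  have hderiv : deriv (phi E) τ = phi E τ / τ := by
    field_simp
    linarith
  rw [hderiv, phi, add_div, add_mul, sum_div, sum_mul]
  congr 1
  · ring
  · refine sum_congr rfl fun l hl => ?_
    obtain ⟨n, rfl⟩ := Nat.exists_eq_add_of_le' (hE l hl)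
    rw [Nat.add_sub_cancel, div_pow]
    field_simp
    ring

/-- The list version of the coloring theorem. -/
theorem exists_avoids_of_numColors_le {τ : ℝ} {L : (v : V) → Finset (α v)}
    (hne : ∀ Z ∈ supports B, Z.Nonempty) (hB : ExtensionBound B k m)
    (hτ : IsTau (lens B k) τ) (hL : ∀ v, numColors B k m τ ≤ (L v).card) :
    ∃ f : (v : V) → α v, (∀ v, f v ∈ L v) ∧ Avoids B f := by
  classical
  set M : ℝ := ⨆ Z : supports B,
    ((deg B k (len k Z) : ℝ) * (m Z : ℝ)) ^ (1 / (len k Z : ℝ)) with hMdef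
  have hle : ∀ Z ∈ supports B,
      ((deg B k (len k Z) : ℝ) * (m Z : ℝ)) ^ (1 / (len k Z : ℝ)) ≤ M := fun Z hZ =>
    le_ciSup (f := fun Z : supports B =>
      ((deg B k (len k Z) : ℝ) * (m Z : ℝ)) ^ (1 / (len k Z : ℝ)))
      (Set.finite_range _).bddAbove ⟨Z, hZ⟩
  have hdm : ∀ Z ∈ supports B, (0 : ℝ) < (deg B k (len k Z) : ℝ) * m Z := by
    intro Z hZ
    have h₁ := one_le_deg (k := k) hZ (hne Z hZ)
    have h₂ := hB.one_le_mult hZ (hne Z hZ)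
    positivity
  have hMpos : 0 < M := by
    obtain ⟨Z, hZ⟩ := hτ.supports_nonempty
    exact (Real.rpow_pos_of_pos (hdm Z hZ) _).trans_le (hle Z hZ)
  have hMpow : ∀ Z ∈ supports B, (deg B k (len k Z) : ℝ) * m Z ≤ M ^ len k Z := by
    intro Z hZ
    have hl := hB.one_le_len hZ (hne Z hZ)
    have := pow_le_pow_left₀ (Real.rpow_nonneg (hdm Z hZ).le _) (hle Z hZ) (len k Z)
    rwa [one_div, Real.rpow_inv_natCast_pow (hdm Z hZ).le (by omega)] at this
  have hβ : 0 < M / τ := div_pos hMpos hτ.1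
  refine exists_avoids_of_sum_le hβ hne hB fun v => ?_
  calc _ ≤ M / τ + ∑ l ∈ lens B k, M ^ l / (M / τ) ^ (l - 1) := by
        gcongr
        exact sum_mult_div_pow_le hβ hne hMpow v
    _ = deriv (phi (lens B k)) τ * M := hτ.add_sum_eq hMpos fun l hl => by
        obtain ⟨Z, hZ, rfl⟩ := mem_image.1 hl
        exact hB.one_le_len hZ (hne Z hZ)
    _ ≤ numColors B k m τ := Nat.le_ceil _
    _ ≤ _ := by exact_mod_cast hL v

end Parameters

end BadColoring

/-! ### Events determined by independent variables -/

namespace VariableVersion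

variable {V Ω X : Type*} {α : V → Type*} {ψ : (v : V) → Ω → α v} {A : X → Set Ω}
  {vbl : X → Finset V}

theorem avoids_badConfigs_iff (hA : ∀ x, DeterminedBy ψ (A x) (vbl x)) (ω : Ω) :
    BadColoring.Avoids (badConfigs ψ A vbl) (fun v => ψ v ω) ↔ ∀ x, ω ∉ A x := by
  constructor
  · intro h x hx
    exact h _ ⟨x, ω, hx, rfl⟩ rfl
  · rintro h _ ⟨x, ω', hω', rfl⟩ he
    exact h x ((hA x ω ω' fun v hv => congrFun he ⟨v, hv⟩).2 hω')

theorem measure_iInter_preimage_singleton_pos [Fintype V] [MeasurableSpace Ω]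
    [∀ v, MeasurableSpace (α v)] [∀ v, MeasurableSingletonClass (α v)] {P : Measure Ω}
    (hψ : iIndepFun ψ P) {f : (v : V) → α v} (hf : ∀ v, 0 < P (ψ v ⁻¹' {f v})) :
    0 < P (⋂ v, ψ v ⁻¹' {f v}) := by
  have h := hψ.measure_inter_preimage_eq_mul Finset.univ (sets := fun v => {f v})
    fun v _ => measurableSet_singleton _
  simp only [Finset.mem_univ, Set.iInter_true] at h
  rw [h]
  exact pos_iff_ne_zero.2 (Finset.prod_ne_zero_iff.2 fun v _ => (hf v).ne')

end VariableVersion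

theorem mainTheorem1 {V : Type*} [Fintype V] :
    -- coloring form
    (∀ {α : Type*} (B : Set (BadColoring.PartialColoring V fun _ => α))
        (k m : Finset V → ℕ) (τ : ℝ),
      (∀ Z ∈ BadColoring.supports B, Z.Nonempty) →
      BadColoring.ExtensionBound B k m →
      BadColoring.IsTau (BadColoring.lens B k) τ →
      ∀ S : Finset α, S.card = BadColoring.numColors B k m τ →
        ∃ f : V → α, (∀ v, f v ∈ S) ∧ BadColoring.Avoids B f) ∧
    -- variable version
    (∀ {Ω X : Type*} {α : V → Type*} [MeasurableSpace Ω] [∀ v, MeasurableSpace (α v)]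
        [∀ v, MeasurableSingletonClass (α v)] (P : Measure Ω) [IsProbabilityMeasure P]
        (ψ : (v : V) → Ω → α v) (A : X → Set Ω) (vbl : X → Finset V),
      (∀ v, Measurable (ψ v)) → iIndepFun ψ P → (∀ v, (Set.range (ψ v)).Finite) →
      (∀ x, VariableVersion.DeterminedBy ψ (A x) (vbl x)) →
      (∀ ω, BadColoring.Avoids (VariableVersion.badConfigs ψ A vbl) (fun v => ψ v ω) ↔
        ∀ x, ω ∉ A x) ∧
      ∀ (k m : Finset V → ℕ) (τ : ℝ),
        (∀ Z ∈ BadColoring.supports (VariableVersion.badConfigs ψ A vbl), Z.Nonempty) →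
        BadColoring.ExtensionBound (VariableVersion.badConfigs ψ A vbl) k m →
        BadColoring.IsTau (BadColoring.lens (VariableVersion.badConfigs ψ A vbl) k) τ →
        (∀ v, BadColoring.numColors (VariableVersion.badConfigs ψ A vbl) k m τ ≤
          {a | 0 < P (ψ v ⁻¹' {a})}.ncard) →
        0 < P (⋂ x, (A x)ᶜ)) := by
  refine ⟨?_, ?_⟩
  · intro α B k m τ hne hB hτ S hS
    exact BadColoring.exists_avoids_of_numColors_le (L := fun _ => S) hne hB hτ fun _ => hS.ge
  · intro Ω X α _ _ _ P _ ψ A vbl _ hind hfin hA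
    refine ⟨VariableVersion.avoids_badConfigs_iff hA, fun k m τ hne hB hτ hN => ?_⟩
    have hfin' : ∀ v, {a | 0 < P (ψ v ⁻¹' {a})}.Finite := fun v =>
      (hfin v).subset fun a (ha : 0 < P (ψ v ⁻¹' {a})) => by
        obtain ⟨ω, hω⟩ := nonempty_of_measure_ne_zero ha.ne'
        exact ⟨ω, hω⟩
    obtain ⟨f, hfL, hf⟩ := BadColoring.exists_avoids_of_numColors_le
      (L := fun v => (hfin' v).toFinset) hne hB hτ fun v => by
        rw [← Set.ncard_eq_toFinset_card _ (hfin' v)]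
        exact hN v
    -- By independence the single outcome f has positive probability, and it lies in no bad event.
    refine (VariableVersion.measure_iInter_preimage_singleton_pos hind (f := f) fun v => by
      simpa using hfL v).trans_le (measure_mono fun ω hω => ?_)
    have hωf : (fun v => ψ v ω) = f := funext fun v => by simpa using Set.mem_iInter.1 hω v
    rw [← hωf] at hf
    simpa using (VariableVersion.avoids_badConfigs_iff hA ω).1 hf
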